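/- Let $\omega(t)=\sqrt{1-t^2}$ on $(-1,1)$, let $P_n(t)=\frac{(-1)^n}{2^n n!}\frac{d^n}{dt^n}(1-t^2)^n$ be the Legendre polynomials, and for integers $0\le m\le n$ put $$Q_n^m:=\Big(\frac{2n+1}{2}\,\frac{(n-m)!}{(n+m)!}\Big)^{1/2}\,\omega^m P_n^{(m)} .$$ For integers $m\ge 0$ and $k\ge 1$ let $$H_m^k:=\Big\{u\in L^2(-1,1) : \|u\|_{m,k}^2:=\sum_{n=m}^\infty (2n+1)^{2k}\,\big|(u,Q_n^m)_{L^2(-1,1)}\big|^2<\infty\Big\},$$ $$X_m^k:=\big\{u\in L^2(-1,1) : \omega^{m+k}(\omega^{-m}u)^{(k)}\in L^2(-1,1)\big\},$$ where functions are real-valued, $(\cdot)^{(k)}$ is the $k$-th derivative in the sense of distributions in $(-1,1)$, and the condition defining $X_m^k$ includes that $(\omega^{-m}u)^{(k)}$ is a locally integrable function in $(-1,1)$. Then, for all integers $m\ge 0$ and $k\ge 1$, $H_m^k=X_m^k$. Moreover, with the positive constant $$C_{m,k}:=\min\Big\{\frac{(m+1)!}{(m+k+1)!}\,\frac{1}{2^{2k}},\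 \frac{(m+\frac12)^{2k}}{(2m+2k-1)^{2k}}\Big\}>0,$$ every $u\in H_m^k$ satisfies $$C_{m,k}\,\|u\|_{m,k}^2\ \le\ \big(m+\tfrac12\big)^{2k}\int_{-1}^1|u|^2+\int_{-1}^1\omega^{2(m+k)}\big|(\omega^{-m}u)^{(k)}\big|^2\ \le\ 2^{1-2k}\,\|u\|_{m,k}^2 .$$ -/

import Mathlib

open MeasureTheory Set Distributions

noncomputable section

namespace LegendreScale

/-- Lebesgue measure on the interval `(-1,1)`. -/
abbrev mu : Measure ℝ := volume.restrict (Ioo (-1) 1)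

/-- The real Hilbert space `L²(-1,1)`. -/
abbrev L2 : Type := Lp ℝ 2 mu

/-- The interval `(-1,1)` as an open set. -/
def I : TopologicalSpace.Opens ℝ := ⟨Ioo (-1) 1, isOpen_Ioo⟩

/-- The weight `ω(t) = √(1 - t²)`. -/
def omega (t : ℝ) : ℝ := √(1 - t ^ 2)

/-- The Legendre polynomial `Pₙ = (-1)ⁿ / (2ⁿ n!) · dⁿ/dtⁿ (1 - t²)ⁿ`. -/
def legendreP (n : ℕ) : Polynomial ℝ :=
  Polynomial.C ((-1) ^ n / (2 ^ n * (n.factorial : ℝ))) *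
    Polynomial.derivative^[n] ((1 - Polynomial.X ^ 2) ^ n)

/-- The associated Legendre function `Pₙᵐ(t) = (1 - t²)^(m/2) Pₙ⁽ᵐ⁾(t)`. -/
def assocLegendre (m n : ℕ) (t : ℝ) : ℝ :=
  omega t ^ m * (Polynomial.derivative^[m] (legendreP n)).eval t

/-- The normalized associated Legendre function `Qₙᵐ`, used for `m ≤ n` only. -/
def Q (m n : ℕ) (t : ℝ) : ℝ :=
  √((2 * n + 1) / 2 * ((n - m).factorial / (n + m).factorial)) * assocLegendre m n t

/-- The coefficient `(u, Qₙᵐ)` in `L²(-1,1)`. -/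
def coeff (m n : ℕ) (u : L2) : ℝ := ∫ t in Ioo (-1) 1, u t * Q m n t

/-- The terms of the series `∑_{n ≥ m} (2n+1)^(2k) (u, Qₙᵐ)²`, reindexed with `n = m + j`. -/
def normTerm (m k : ℕ) (u : L2) (j : ℕ) : ℝ :=
  (2 * ((m + j : ℕ) : ℝ) + 1) ^ (2 * k) * coeff m (m + j) u ^ 2

/-- The space `H_m^k` of the Hilbert scale of the pairs `(Qₙᵐ, 2n+1)`, `n ≥ m`. -/
def H (m k : ℕ) : Set L2 := {u | Summable (normTerm m k u)}

/-- The norm `‖u‖_{m,k}` of `H_m^k`. -/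
def hNorm (m k : ℕ) (u : L2) : ℝ := √(∑' j, normTerm m k u j)

/-- `g` is the `k`-th derivative of `f` in the sense of distributions in `(-1,1)`;
both functions are locally integrable in `(-1,1)`. -/
structure IsWeakDeriv (k : ℕ) (f g : ℝ → ℝ) : Prop where
  locallyIntegrable_left : LocallyIntegrableOn f (Ioo (-1) 1)
  locallyIntegrable_right : LocallyIntegrableOn g (Ioo (-1) 1)
  integral_eq : ∀ φ : 𝓓(I, ℝ),
    ∫ t in Ioo (-1) 1, f t * iteratedDeriv k φ t = (-1) ^ k * ∫ t in Ioo (-1) 1, g t * φ t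

/-- The function `ω^{-m} u`. -/
def unweight (m : ℕ) (u : L2) (t : ℝ) : ℝ := (omega t ^ m)⁻¹ * u t

/-- The weighted Sobolev space `X_m^k = {u ∈ L² : ω^{m+k} (ω^{-m} u)⁽ᵏ⁾ ∈ L²}`. -/
def X (m k : ℕ) : Set L2 :=
  {u | ∃ g, IsWeakDeriv k (unweight m u) g ∧ MemLp (fun t => omega t ^ (m + k) * g t) 2 mu}

/-- The constant `C_{m,k}` of the lower bound. -/
def lowerConst (m k : ℕ) : ℝ :=
  min ((m + 1).factorial / (m + k + 1).factorial * (1 / 2 ^ (2 * k)))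
    (((m : ℝ) + 1 / 2) ^ (2 * k) / (2 * (m : ℝ) + 2 * k - 1) ^ (2 * k))

end LegendreScale

end

/-!
Write `λₙ = eig m k n = ∏_{i < k} (n - m - i) (n + m + i + 1)`. The `k`-th derivative maps
`ω^(-m) Qₙᵐ` to a multiple of `ω^(-(m+k)) Qₙ^(m+k)`, and after normalization the square of the factor
is `λₙ`. Both systems `(Qₙᵐ)_{n ≥ m}` and `(Qₙ^(m+k))_{n ≥ m+k}` are Hilbert bases of `L²(-1,1)`
(`qBasis`), so Parseval's identity gives
`∫ ω^(2(m+k)) |(ω^(-m) u)^(k)|² = ∑ λₙ (u, Qₙᵐ)²` (`hasSum_eig_mul_coeff_sq`). The theorem then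
amounts to comparing `(m + 1/2)^(2k) + λₙ` with `(2n+1)^(2k)` for each `n`
(`lowerConst_mul_le`, `le_zpow_mul`).

The algebra rests on `iterate_derivative_weighted_dLegendre`, the adjoint form
`((1 - X²)^(m+k) Pₙ^(m+k))^(k) = (-1)^k λₙ (1 - X²)^m Pₙ^(m)`, which follows from the differential
equation of `Pₙ⁽ʲ⁾`; it also yields the orthogonality relations. Completeness follows from the
Weierstrass approximation theorem, since the `Pₙ⁽ᵐ⁾`, `n ≥ m`, span all polynomials.

For `u ∈ X` the coefficients of `ω^(m+k) (ω^(-m) u)^(k)` are found by testing the weak derivative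
against `(1 - t²)^(m+k) Pₙ^(m+k)` (`IsWeakDeriv.coeff_toLp_sq`). This function is not compactly
supported in `(-1,1)`; it is cut off by `Ψ((1 - t²)/ε)`, and the derivatives of the cut-off function
up to order `k` are dominated uniformly in `ε` because `1 - t²` occurs to a sufficiently high power
(`exists_bound_iteratedDeriv_cutoff`). Conversely, for `u ∈ H` Riesz–Fischer provides an element
`w` of `L²(-1,1)` with the required coefficients, and `ω^(-(m+k)) w` is the weak derivative
(`isWeakDeriv_unweight`), by Parseval's identity against a test function. Weak derivatives are unique
(`IsWeakDeriv.ae_eq`), so the estimates hold for every version of the derivative.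
-/

noncomputable section

namespace Legendre
open Polynomial
open LegendreScale (legendreP)

/-! ### Derivatives of Legendre polynomials -/

/-- The `m`-th derivative of the Legendre polynomial `Pₙ`. -/
def dLegendre (m n : ℕ) : ℝ[X] := derivative^[m] (legendreP n)

/-- The eigenvalue `∏_{i < k} (n - m - i) (n + m + i + 1)` linking the orders `m` and `m + k`. -/
def eig (m k n : ℕ) : ℝ :=
  ∏ i ∈ Finset.range k, ((n : ℝ) - (m + i : ℕ)) * ((n : ℝ) + (m + i : ℕ) + 1)

theorem derivative_dLegendre (m n : ℕ) : derivative (dLegendre m n) = dLegendre (m + 1) n := by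
  simp [dLegendre, Function.iterate_succ_apply']

theorem iterate_derivative_dLegendre (m k n : ℕ) :
    derivative^[k] (dLegendre m n) = dLegendre (m + k) n := by
  rw [dLegendre, dLegendre, ← Function.iterate_add_apply, add_comm]

theorem eig_succ (m k n : ℕ) :
    eig m (k + 1) n = eig m k n * (((n : ℝ) - (m + k : ℕ)) * ((n : ℝ) + (m + k : ℕ) + 1)) :=
  Finset.prod_range_succ _ _

/-- Leibniz' rule applied to `(1 - X²) y' + 2 n X y = 0` for `y = (1 - X²)ⁿ`. -/
theorem ode_rodrigues (n r : ℕ) :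
    (1 - X ^ 2) * derivative^[r + 2] ((1 - X ^ 2 : ℝ[X]) ^ n)
      + C (2 * ((n : ℝ) - r - 1)) * X * derivative^[r + 1] ((1 - X ^ 2) ^ n)
      + C (((r : ℝ) + 1) * (2 * n - r)) * derivative^[r] ((1 - X ^ 2) ^ n) = 0 := by
  induction r with
  | zero =>
    have h : (1 - X ^ 2) * derivative ((1 - X ^ 2 : ℝ[X]) ^ n)
        + C (2 * (n : ℝ)) * X * (1 - X ^ 2) ^ n = 0 := by
      rcases n with _ | n
      · simp
      · simp [derivative_pow]
        ring
    have h2 := congrArg derivative h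
    simp only [derivative_add, derivative_mul, derivative_sub, derivative_one, derivative_X_pow,
      derivative_C, derivative_X, derivative_zero] at h2
    simp only [Function.iterate_succ_apply', Function.iterate_zero_apply] at h2 ⊢
    rw [← h2]
    simp only [map_mul, map_sub, map_add, Nat.cast_zero, map_natCast, map_one, map_zero, map_ofNat]
    ring_nf
  | succ r ih =>
    have h2 := congrArg derivative ih
    simp only [derivative_add, derivative_mul, derivative_sub, derivative_one, derivative_X_pow,
      derivative_C, derivative_X, derivative_zero, ← Function.iterate_succ_apply' derivative] at h2
    rw [← h2]
    simp only [map_mul, map_sub, map_add, Nat.cast_add, Nat.cast_one, map_natCast, map_one,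
      map_ofNat, Nat.succ_eq_add_one]
    ring_nf

/-- The differential equation of `Pₙ⁽ʲ⁾`. -/
theorem ode_dLegendre (j n : ℕ) :
    (1 - X ^ 2) * dLegendre (j + 2) n - C (2 * ((j : ℝ) + 1)) * X * dLegendre (j + 1) n
      + C (((n : ℝ) - j) * (n + j + 1)) * dLegendre j n = 0 := by
  have h := congrArg (C ((-1) ^ n / (2 ^ n * (n.factorial : ℝ))) * ·) (ode_rodrigues n (n + j))
  simp only [mul_zero] at h
  rw [← h]
  simp only [dLegendre, legendreP, iterate_derivative_C_mul, ← Function.iterate_add_apply]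
  rw [show n + j + 2 = j + 2 + n by ring, show n + j + 1 = j + 1 + n by ring, add_comm n j]
  simp only [map_mul, map_sub, map_add, Nat.cast_add, map_natCast, map_one, map_ofNat]
  ring

theorem derivative_weighted_dLegendre (j n : ℕ) :
    derivative ((1 - X ^ 2) ^ (j + 1) * dLegendre (j + 1) n) =
      -(C (((n : ℝ) - j) * (n + j + 1)) * ((1 - X ^ 2) ^ j * dLegendre j n)) := by
  have h := ode_dLegendre j n
  rw [derivative_mul, derivative_dLegendre, derivative_pow]
  simp only [derivative_sub, derivative_one, derivative_X_pow, add_tsub_cancel_right,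
    map_mul, map_add, map_natCast, map_one, map_ofNat, Nat.cast_add, Nat.cast_one] at h ⊢
  linear_combination (1 - X ^ 2) ^ j * h

/-- Rodrigues-type formula
`((1 - X²)^(m+k) Pₙ^(m+k))^(k) = (-1)^k λ (1 - X²)^m Pₙ^(m)` with `λ = eig m k n`. -/
theorem iterate_derivative_weighted_dLegendre (m k n : ℕ) :
    derivative^[k] ((1 - X ^ 2) ^ (m + k) * dLegendre (m + k) n) =
      C ((-1) ^ k * eig m k n) * ((1 - X ^ 2) ^ m * dLegendre m n) := by
  induction k with
  | zero => simp [eig]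
  | succ k ih =>
    rw [Function.iterate_succ_apply, ← add_assoc, derivative_weighted_dLegendre,
      ← neg_mul, ← C_neg, iterate_derivative_C_mul, ih, eig_succ, ← mul_assoc, ← C_mul]
    congr 2
    push_cast
    ring

theorem eig_mul_factorial (m k j : ℕ) :
    eig m k (m + k + j) * (j.factorial * (2 * m + k + j).factorial) =
      (k + j).factorial * (2 * m + 2 * k + j).factorial := by
  induction k generalizing j with
  | zero => simp [eig]
  | succ k ih =>
    have h := ih (j + 1)
    rw [show m + (k + 1) + j = m + k + (j + 1) by ring, eig_succ]
    rw [show 2 * m + k + (j + 1) = 2 * m + (k + 1) + j by ring,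
      show 2 * m + 2 * k + (j + 1) = 2 * m + 2 * k + j + 1 by ring, Nat.factorial_succ j] at h
    rw [show 2 * m + 2 * (k + 1) + j = 2 * m + 2 * k + j + 1 + 1 by ring,
      Nat.factorial_succ (2 * m + 2 * k + j + 1), show k + 1 + j = k + (j + 1) by ring]
    push_cast at h ⊢
    linear_combination (2 * (m : ℝ) + 2 * k + j + 2) * h

theorem natDegree_iterate_derivative_eq (p : ℝ[X]) (k : ℕ) :
    (derivative^[k] p).natDegree = p.natDegree - k := by
  induction k with
  | zero => simp
  | succ k ih => rw [Function.iterate_succ_apply', natDegree_derivative, ih, Nat.sub_sub]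

theorem natDegree_one_sub_X_sq_pow (n : ℕ) : ((1 - X ^ 2 : ℝ[X]) ^ n).natDegree = 2 * n := by
  have : (1 - X ^ 2 : ℝ[X]).natDegree = 2 := by compute_degree!
  rw [natDegree_pow, this, mul_comm]

theorem iterate_derivative_two_mul (n : ℕ) :
    derivative^[2 * n] ((1 - X ^ 2 : ℝ[X]) ^ n) = C ((-1) ^ n * ((2 * n).factorial : ℝ)) := by
  have hd := natDegree_one_sub_X_sq_pow n
  have h0 : (derivative^[2 * n] ((1 - X ^ 2 : ℝ[X]) ^ n)).natDegree = 0 := by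
    rw [natDegree_iterate_derivative_eq, hd, Nat.sub_self]
  rw [eq_C_of_natDegree_eq_zero h0, coeff_iterate_derivative]
  have hl : ((1 - X ^ 2 : ℝ[X]) ^ n).coeff (2 * n) = (-1) ^ n := by
    rw [← hd, coeff_natDegree, leadingCoeff_pow]
    congr 1
    have : (1 - X ^ 2 : ℝ[X]).natDegree = 2 := by compute_degree!
    rw [leadingCoeff, this]
    simp [coeff_one]
  rw [zero_add, hl, Nat.descFactorial_self]
  simp [mul_comm]

theorem dLegendre_self (n : ℕ) :
    dLegendre n n = C (((2 * n).factorial : ℝ) / (2 ^ n * n.factorial)) := by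
  rw [dLegendre, legendreP, iterate_derivative_C_mul, ← Function.iterate_add_apply, ← two_mul,
    iterate_derivative_two_mul, ← C_mul]
  congr 1
  have : ((-1 : ℝ) ^ n) * (-1) ^ n = 1 := by rw [← mul_pow]; simp
  linear_combination ((2 * n).factorial : ℝ) / (2 ^ n * n.factorial) * this

theorem dLegendre_eq_zero {m n : ℕ} (h : n < m) : dLegendre m n = 0 := by
  obtain ⟨d, rfl⟩ := Nat.exists_eq_add_of_lt h
  rw [add_assoc, ← iterate_derivative_dLegendre, dLegendre_self, iterate_derivative_C (by omega)]

theorem degree_dLegendre (m j : ℕ) : (dLegendre m (m + j)).degree = j := by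
  have h1 : dLegendre (m + j) (m + j) ≠ 0 := by
    rw [dLegendre_self]
    simp only [ne_eq, C_eq_zero]
    positivity
  have h2 := iterate_derivative_dLegendre m j (m + j)
  have h3 : dLegendre m (m + j) ≠ 0 := by
    intro h
    rw [h, iterate_derivative_zero] at h2
    exact h1 h2.symm
  have h4 : j ≤ (dLegendre m (m + j)).natDegree := by
    by_contra hlt
    rw [iterate_derivative_eq_zero (not_le.1 hlt)] at h2
    exact h1 h2.symm
  have h5 : (dLegendre m (m + j)).natDegree ≤ j := by
    rw [dLegendre, natDegree_iterate_derivative_eq, legendreP]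
    have := natDegree_C_mul_le ((-1) ^ (m + j) / (2 ^ (m + j) * ((m + j).factorial : ℝ)))
      (derivative^[m + j] ((1 - X ^ 2) ^ (m + j)))
    rw [natDegree_iterate_derivative_eq, natDegree_one_sub_X_sq_pow] at this
    omega
  rw [degree_eq_natDegree h3, le_antisymm h5 h4]

theorem span_dLegendre (m : ℕ) :
    Submodule.span ℝ (Set.range fun j => dLegendre m (m + j)) = ⊤ := by
  let S : Polynomial.Sequence ℝ := ⟨fun j => dLegendre m (m + j), degree_dLegendre m⟩
  exact S.span fun i => (leadingCoeff_ne_zero.2 (S.ne_zero i)).isUnit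

/-! ### Orthogonality relations -/

theorem integral_derivative_eval (p : ℝ[X]) :
    ∫ t in (-1 : ℝ)..1, (derivative p).eval t = p.eval 1 - p.eval (-1) :=
  intervalIntegral.integral_eq_sub_of_hasDerivAt (fun t _ => p.hasDerivAt t)
    ((derivative p).continuous.intervalIntegrable _ _)

theorem integral_eval_add (p q : ℝ[X]) : ∫ t in (-1 : ℝ)..1, (p + q).eval t =
    (∫ t in (-1 : ℝ)..1, p.eval t) + ∫ t in (-1 : ℝ)..1, q.eval t := by
  simp only [eval_add]
  exact intervalIntegral.integral_add (p.continuous.intervalIntegrable _ _)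
    (q.continuous.intervalIntegrable _ _)

theorem integral_eval_C_mul (a : ℝ) (p : ℝ[X]) :
    ∫ t in (-1 : ℝ)..1, (C a * p).eval t = a * ∫ t in (-1 : ℝ)..1, p.eval t := by
  simp

/-- The weighted inner product of `Pₙ⁽ᵐ⁾` and `Pₗ⁽ᵐ⁾`. -/
def gram (m n l : ℕ) : ℝ :=
  ∫ t in (-1 : ℝ)..1, ((1 - X ^ 2) ^ m * dLegendre m n * dLegendre m l).eval t

theorem gram_comm (m n l : ℕ) : gram m n l = gram m l n := by
  rw [gram, gram, mul_right_comm]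

/-- Integration by parts; the boundary terms vanish because of the factor `(1 - X²)^(m+1)`. -/
theorem gram_succ (m n l : ℕ) :
    gram (m + 1) n l = ((n : ℝ) - m) * (n + m + 1) * gram m n l := by
  have h := integral_derivative_eval ((1 - X ^ 2) ^ (m + 1) * dLegendre (m + 1) n * dLegendre m l)
  have e : derivative ((1 - X ^ 2) ^ (m + 1) * dLegendre (m + 1) n * dLegendre m l) =
      C (-(((n : ℝ) - m) * (n + m + 1))) * ((1 - X ^ 2) ^ m * dLegendre m n * dLegendre m l)
      + (1 - X ^ 2) ^ (m + 1) * dLegendre (m + 1) n * dLegendre (m + 1) l := by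
    rw [derivative_mul, derivative_weighted_dLegendre, derivative_dLegendre, C_neg]
    ring
  rw [e, integral_eval_add, integral_eval_C_mul] at h
  simp only [eval_mul, eval_pow, eval_sub, eval_one, eval_X] at h
  norm_num at h
  rw [gram, gram]
  simp only [eval_mul, eval_pow, eval_sub, eval_one, eval_X]
  linear_combination h

theorem gram_eq_eig_mul (m n l : ℕ) : gram m n l = eig 0 m n * gram 0 n l := by
  induction m with
  | zero => simp [eig]
  | succ m ih => rw [gram_succ, ih, eig_succ]; push_cast; ring

/-- `n (n + 1)` and `l (l + 1)` are different eigenvalues of the symmetric Legendre operator. -/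
theorem gram_zero_of_ne {n l : ℕ} (h : n ≠ l) : gram 0 n l = 0 := by
  have h1 := gram_succ 0 n l
  rw [gram_comm, gram_succ, gram_comm 0 l n] at h1
  push_cast at h1
  have h2 : ((n : ℝ) - l) * (n + l + 1) * gram 0 n l = 0 := by linear_combination -h1
  have h3 : (n : ℝ) - l ≠ 0 := sub_ne_zero.2 (by exact_mod_cast h)
  have h4 : (n : ℝ) + l + 1 ≠ 0 := by positivity
  simpa [h3, h4] using h2

theorem integral_one_sub_sq_pow (n : ℕ) :
    (∫ t in (-1 : ℝ)..1, ((1 - X ^ 2 : ℝ[X]) ^ n).eval t) * (2 * n + 1).factorial =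
      2 * 4 ^ n * (n.factorial : ℝ) ^ 2 := by
  induction n with
  | zero => norm_num
  | succ n ih =>
    have h := integral_derivative_eval (X * (1 - X ^ 2) ^ (n + 1))
    have e : derivative (X * (1 - X ^ 2 : ℝ[X]) ^ (n + 1)) =
        C (2 * (n : ℝ) + 3) * (1 - X ^ 2) ^ (n + 1) +
          C (-(2 * ((n : ℝ) + 1))) * (1 - X ^ 2) ^ n := by
      have h2 : (C 2 : ℝ[X]) = 2 := rfl
      have h3 : (C 3 : ℝ[X]) = 3 := rfl
      rw [derivative_mul, derivative_pow]
      simp [h2, h3]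
      ring
    rw [e, integral_eval_add, integral_eval_C_mul, integral_eval_C_mul] at h
    rw [show 2 * (n + 1) + 1 = 2 * n + 1 + 1 + 1 by ring, Nat.factorial_succ (2 * n + 1 + 1),
      Nat.factorial_succ (2 * n + 1), Nat.factorial_succ n]
    simp only [eval_mul, eval_X, eval_pow, eval_sub, eval_one] at h
    norm_num at h
    simp only [eval_pow, eval_sub, eval_one, eval_X] at ih ⊢
    push_cast
    linear_combination (2 * (n : ℝ) + 2) * (2 * n + 1).factorial * h
      + (2 * (n : ℝ) + 2) ^ 2 * ih

/-- The norm of `Pₙ` comes from that of the constant `Pₙ⁽ⁿ⁾` in the weight `(1 - t²)ⁿ`. -/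
theorem gram_zero_self (n : ℕ) : gram 0 n n = 2 / (2 * n + 1) := by
  have h1 := gram_eq_eig_mul n n n
  have h2 := eig_mul_factorial 0 n 0
  have h3 := integral_one_sub_sq_pow n
  have h4 : gram n n n = (((2 * n).factorial : ℝ) / (2 ^ n * n.factorial)) ^ 2 *
      ∫ t in (-1 : ℝ)..1, ((1 - X ^ 2 : ℝ[X]) ^ n).eval t := by
    rw [gram, dLegendre_self, ← integral_eval_C_mul, C_pow]
    congr 1
    ext t
    congr 1
    ring
  rw [Nat.factorial_succ] at h3
  simp only [Nat.factorial_zero, mul_zero, zero_add, add_zero, Nat.cast_one, one_mul] at h2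
  have hn : (n.factorial : ℝ) ≠ 0 := by positivity
  have hn2 : ((2 * n).factorial : ℝ) ≠ 0 := by positivity
  have h5 : eig 0 n n = (2 * n).factorial := by
    apply mul_right_cancel₀ hn
    linear_combination h2
  rw [h5, h4] at h1
  have h1' := mul_left_cancel₀ hn2 (h1.symm.trans (by ring : _ = ((2 * n).factorial : ℝ) *
    (((2 * n).factorial : ℝ) * (1 / (2 ^ n * n.factorial)) ^ 2 *
      ∫ t in (-1 : ℝ)..1, ((1 - X ^ 2 : ℝ[X]) ^ n).eval t)))
  rw [h1', eq_div_iff (by positivity)]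
  push_cast at h3
  have h6 : (4 : ℝ) ^ n = 2 ^ n * 2 ^ n := by rw [← mul_pow]; norm_num
  rw [h6] at h3
  field_simp
  linear_combination h3

/-- The normalizing constant of `Qₙᵐ`. -/
def normConst (m n : ℕ) : ℝ := √((2 * n + 1) / 2 * ((n - m).factorial / (n + m).factorial))

theorem normConst_pos (m n : ℕ) : 0 < normConst m n := by
  unfold normConst
  positivity

theorem normConst_sq (m n : ℕ) :
    normConst m n ^ 2 = (2 * n + 1) / 2 * ((n - m).factorial / (n + m).factorial) :=
  Real.sq_sqrt (by positivity)

theorem normConst_sq_eq_eig_mul (m k j : ℕ) : normConst m (m + k + j) ^ 2 =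
    eig m k (m + k + j) * normConst (m + k) (m + k + j) ^ 2 := by
  have h := eig_mul_factorial m k j
  rw [normConst_sq, normConst_sq, show m + k + j - m = k + j by omega,
    show m + k + j - (m + k) = j by omega, show m + k + j + m = 2 * m + k + j by ring,
    show m + k + j + (m + k) = 2 * m + 2 * k + j by ring]
  have h2 : ((k + j).factorial : ℝ) / (2 * m + k + j).factorial =
      eig m k (m + k + j) * (j.factorial / (2 * m + 2 * k + j).factorial) := by
    rw [← mul_div_assoc, div_eq_div_iff (by positivity) (by positivity)]
    linear_combination -h
  rw [h2]
  ring

theorem normConst_mul_gram (m i j : ℕ) :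
    normConst m (m + i) * normConst m (m + j) * gram m (m + i) (m + j) =
      if i = j then 1 else 0 := by
  split_ifs with h
  · subst h
    have h1 := eig_mul_factorial 0 m i
    rw [← sq, normConst_sq, gram_eq_eig_mul, gram_zero_self, show m + i - m = i by omega,
      show m + i + m = 2 * m + i by ring]
    simp only [mul_zero, zero_add] at h1
    have h2 : eig 0 m (m + i) * (i.factorial / (2 * m + i).factorial) = 1 := by
      rw [← mul_div_assoc, div_eq_one_iff_eq (by positivity)]
      have h3 : ((m + i).factorial : ℝ) ≠ 0 := by positivity
      apply mul_right_cancel₀ h3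
      linear_combination h1
    have h4 : (2 * ((m + i : ℕ) : ℝ) + 1) ≠ 0 := by positivity
    field_simp at h2 ⊢
    linear_combination h2
  · rw [gram_eq_eig_mul, gram_zero_of_ne (by omega)]
    simp

/-! ### Bounds for the eigenvalues -/

theorem eig_factor (a x : ℝ) : (x - a) * (x + a + 1) = (x + 1 / 2) ^ 2 - (a + 1 / 2) ^ 2 := by ring

theorem eig_eq_zero {m k j : ℕ} (h : j < k) : eig m k (m + j) = 0 := by
  rw [eig, Finset.prod_eq_zero (Finset.mem_range.2 h)]
  simp

theorem eig_le (m k j : ℕ) : eig m k (m + j) ≤ (((m + j : ℕ) : ℝ) + 1 / 2) ^ (2 * k) := by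
  rcases lt_or_ge j k with h | h
  · rw [eig_eq_zero h]
    positivity
  · rw [pow_mul, ← Finset.card_range k, ← Finset.prod_const, Finset.card_range, eig]
    refine Finset.prod_le_prod (fun i hi => ?_) fun i hi => ?_
    · have : (i : ℝ) ≤ j := by exact_mod_cast (Finset.mem_range.1 hi).le.trans h
      push_cast
      have h2 : 0 ≤ (m : ℝ) + j - (m + i) := by linarith
      positivity
    · rw [eig_factor]
      have := sq_nonneg (((m + i : ℕ) : ℝ) + 1 / 2)
      linarith

/-- Each factor `(n + 1/2)² - (a + 1/2)²` of `eig m k n`, where `a = m + i ≤ n - 1`, is at least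
`(n + 1/2)² / (a + 2)`; the product of the numbers `1 / (a + 2)` is the quotient of factorials. -/
theorem le_eig (m k j : ℕ) (h : k ≤ j) :
    ((m + 1).factorial / (m + k + 1).factorial : ℝ) * (((m + j : ℕ) : ℝ) + 1 / 2) ^ (2 * k) ≤
      eig m k (m + j) := by
  have hf : ((m + 1).factorial / (m + k + 1).factorial : ℝ) =
      ∏ i ∈ Finset.range k, (1 / ((m : ℝ) + i + 2)) := by
    clear h
    induction k with
    | zero => simp [div_self (show ((m + 1).factorial : ℝ) ≠ 0 by positivity)]
    | succ k ih =>
      rw [Finset.prod_range_succ, ← ih, show m + (k + 1) + 1 = m + k + 1 + 1 by ring,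
        Nat.factorial_succ (m + k + 1)]
      push_cast
      have : (m : ℝ) + k + 2 ≠ 0 := by positivity
      have : (m : ℝ) + k + 1 + 1 ≠ 0 := by positivity
      field_simp
      ring
  have hp : (((m + j : ℕ) : ℝ) + 1 / 2) ^ (2 * k) =
      ∏ _i ∈ Finset.range k, (((m + j : ℕ) : ℝ) + 1 / 2) ^ 2 := by simp [pow_mul]
  rw [hf, hp, ← Finset.prod_mul_distrib, eig]
  refine Finset.prod_le_prod (fun i hi => by positivity) fun i hi => ?_
  rw [eig_factor]
  have hi' : (i : ℝ) + 1 ≤ j := by exact_mod_cast (Finset.mem_range.1 hi).trans_le h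
  push_cast
  set a : ℝ := m + i with ha
  have ha0 : 0 ≤ a := by positivity
  set N : ℝ := m + j + 1 / 2 with hN
  have hNa : a + 3 / 2 ≤ N := by linarith
  have hN2 : (a + 3 / 2) ^ 2 ≤ N ^ 2 := by gcongr
  rw [one_div, inv_mul_le_iff₀ (by positivity)]
  nlinarith [mul_le_mul_of_nonneg_left hN2 (by linarith : (0 : ℝ) ≤ a + 1)]

end Legendre

namespace LegendreScale
open Polynomial Legendre Filter Topology ContDiff

/-! ### The Hilbert bases of associated Legendre functions -/

theorem continuous_omega : Continuous omega := by
  unfold omega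
  fun_prop

theorem one_sub_sq_pos {t : ℝ} (ht : t ∈ Ioo (-1 : ℝ) 1) : 0 < 1 - t ^ 2 := by
  nlinarith [ht.1, ht.2]

theorem omega_pos {t : ℝ} (ht : t ∈ Ioo (-1 : ℝ) 1) : 0 < omega t :=
  Real.sqrt_pos.2 (one_sub_sq_pos ht)

theorem omega_sq {t : ℝ} (ht : t ∈ Ioo (-1 : ℝ) 1) : omega t ^ 2 = 1 - t ^ 2 :=
  Real.sq_sqrt (one_sub_sq_pos ht).le

theorem omega_pow_mul_self {t : ℝ} (ht : t ∈ Ioo (-1 : ℝ) 1) (m : ℕ) :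
    omega t ^ m * omega t ^ m = (1 - t ^ 2) ^ m := by
  rw [← mul_pow, ← sq, omega_sq ht]

theorem Q_eq (m n : ℕ) (t : ℝ) :
    Q m n t = normConst m n * (omega t ^ m * (dLegendre m n).eval t) := rfl

theorem continuous_Q (m n : ℕ) : Continuous (Q m n) := by
  have h1 := continuous_omega
  have h2 := (dLegendre m n).continuous
  have : Q m n = fun t => normConst m n * (omega t ^ m * (dLegendre m n).eval t) := rfl
  rw [this]
  fun_prop

theorem exists_bound_Ioo {f : ℝ → ℝ} (hf : Continuous f) :
    ∃ C, 0 ≤ C ∧ ∀ t ∈ Ioo (-1 : ℝ) 1, |f t| ≤ C := by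
  obtain ⟨C, hC⟩ := (isCompact_Icc (a := (-1 : ℝ)) (b := 1)).exists_bound_of_continuousOn
    hf.continuousOn
  exact ⟨C, (norm_nonneg _).trans (hC 0 (by norm_num)), fun t ht => hC t (Ioo_subset_Icc_self ht)⟩

theorem ae_mem_Ioo : ∀ᵐ t ∂mu, t ∈ Ioo (-1 : ℝ) 1 := ae_restrict_mem measurableSet_Ioo

theorem memLp_of_continuous {f : ℝ → ℝ} (hf : Continuous f) : MemLp f 2 mu := by
  obtain ⟨C, -, hC⟩ := exists_bound_Ioo hf
  exact MemLp.of_bound hf.aestronglyMeasurable C (ae_mem_Ioo.mono hC)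

theorem integrable_mul_of_memLp {f g : ℝ → ℝ} (hf : MemLp f 2 mu) (hg : MemLp g 2 mu) :
    Integrable (fun t => f t * g t) mu := hf.integrable_mul hg

theorem inner_toLp {f : ℝ → ℝ} (hf : MemLp f 2 mu) (u : L2) :
    inner ℝ u (hf.toLp f) = ∫ t in Ioo (-1 : ℝ) 1, u t * f t := by
  rw [L2.inner_def]
  refine integral_congr_ae ?_
  filter_upwards [hf.coeFn_toLp] with t ht
  rw [ht]
  simp [mul_comm]

/-- The function `Qₙᵐ` as an element of `L²(-1,1)`. -/
def qVec (m n : ℕ) : L2 := (memLp_of_continuous (continuous_Q m n)).toLp (Q m n)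

theorem coeff_eq_inner (m n : ℕ) (u : L2) : coeff m n u = inner ℝ u (qVec m n) :=
  (inner_toLp _ u).symm

theorem integral_Ioo_eq (f : ℝ → ℝ) :
    ∫ t in Ioo (-1 : ℝ) 1, f t = ∫ t in (-1 : ℝ)..1, f t := by
  rw [intervalIntegral.integral_of_le (by norm_num), integral_Ioc_eq_integral_Ioo]

theorem orthonormal_qVec (m : ℕ) : Orthonormal ℝ fun j => qVec m (m + j) := by
  rw [orthonormal_iff_ite]
  intro i j
  rw [← normConst_mul_gram, gram, ← coeff_eq_inner, coeff, ← integral_Ioo_eq,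
    ← integral_const_mul]
  refine integral_congr_ae ?_
  filter_upwards [(memLp_of_continuous (continuous_Q m (m + i))).coeFn_toLp, ae_mem_Ioo]
    with t ht hI
  rw [qVec, ht, Q_eq, Q_eq]
  simp only [eval_mul, eval_pow, eval_sub, eval_one, eval_X]
  rw [← omega_pow_mul_self hI]
  ring

/-- An integrable function on `(-1,1)` with vanishing moments vanishes, by the Weierstrass
approximation theorem. -/
theorem ae_eq_zero_of_moments {f : ℝ → ℝ} (hf : Integrable f mu)
    (h : ∀ p : ℝ[X], ∫ t in Ioo (-1 : ℝ) 1, f t * p.eval t = 0) : f =ᵐ[mu] 0 := by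
  have key : ∀ φ : ℝ → ℝ, Continuous φ → ∫ t in Ioo (-1 : ℝ) 1, f t * φ t = 0 := by
    intro φ hφ
    have hb : ∀ ε > 0, |∫ t in Ioo (-1 : ℝ) 1, f t * φ t| ≤
        ε * ∫ t in Ioo (-1 : ℝ) 1, |f t| := by
      intro ε hε
      obtain ⟨p, hp⟩ := exists_polynomial_near_of_continuousOn (-1) 1 φ hφ.continuousOn ε hε
      have hi : ∀ ψ : ℝ → ℝ, Continuous ψ → Integrable (fun t => f t * ψ t) mu := by
        intro ψ hψ
        obtain ⟨C, -, hC⟩ := exists_bound_Ioo hψ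
        exact hf.mul_bdd hψ.aestronglyMeasurable (ae_mem_Ioo.mono hC)
      have h1 : ∫ t in Ioo (-1 : ℝ) 1, f t * φ t =
          ∫ t in Ioo (-1 : ℝ) 1, (f t * φ t - f t * p.eval t) := by
        rw [integral_sub (hi φ hφ) (hi _ p.continuous), h p, sub_zero]
      rw [h1, ← integral_const_mul, ← Real.norm_eq_abs]
      refine norm_integral_le_of_norm_le (hf.abs.const_mul ε) ?_
      filter_upwards [ae_mem_Ioo] with t ht
      rw [← mul_sub, Real.norm_eq_abs, abs_mul, mul_comm, abs_sub_comm]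
      gcongr
      exact (hp t (Ioo_subset_Icc_self ht)).le
    have h0 : 0 ≤ ∫ t in Ioo (-1 : ℝ) 1, |f t| := integral_nonneg fun t => abs_nonneg _
    rw [← abs_nonpos_iff]
    refine le_of_forall_pos_le_add fun δ hδ => ?_
    refine (hb (δ / ((∫ t in Ioo (-1 : ℝ) 1, |f t|) + 1)) (by positivity)).trans ?_
    rw [zero_add, div_mul_eq_mul_div, div_le_iff₀ (by positivity)]
    nlinarith
  have := isOpen_Ioo.ae_eq_zero_of_integral_contDiff_smul_eq_zero (μ := volume)
    (IntegrableOn.locallyIntegrableOn hf) (fun g hg _ hs => by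
      rw [← setIntegral_eq_integral_of_forall_compl_eq_zero (s := Ioo (-1 : ℝ) 1)]
      · rw [← key g hg.continuous]
        simp only [smul_eq_mul, mul_comm]
      · intro t ht
        rw [image_eq_zero_of_notMem_tsupport fun h' => ht (hs h'), zero_smul])
  exact (ae_restrict_iff' measurableSet_Ioo).2 this

theorem eq_zero_of_inner_qVec (m : ℕ) {u : L2} (h : ∀ j, inner ℝ u (qVec m (m + j)) = 0) :
    u = 0 := by
  have hω : MemLp (fun t => omega t ^ m) 2 mu := memLp_of_continuous (continuous_omega.pow m)
  have hi := integrable_mul_of_memLp (Lp.memLp u) hω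
  have hz : (fun t => u t * omega t ^ m) =ᵐ[mu] 0 := by
    refine ae_eq_zero_of_moments hi fun p => ?_
    -- The moments vanish for the polynomials `Pₙ⁽ᵐ⁾`, `n ≥ m`, which span all polynomials.
    have hp : p ∈ Submodule.span ℝ (Set.range fun j => dLegendre m (m + j)) := by
      rw [span_dLegendre]
      trivial
    have hint : ∀ q : ℝ[X], Integrable (fun t => u t * omega t ^ m * q.eval t) mu := by
      intro q
      obtain ⟨C, -, hC⟩ := exists_bound_Ioo q.continuous
      exact hi.mul_bdd q.continuous.aestronglyMeasurable (ae_mem_Ioo.mono hC)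
    induction hp using Submodule.span_induction with
    | mem q hq =>
      obtain ⟨j, rfl⟩ := hq
      have hj := h j
      rw [← coeff_eq_inner, coeff] at hj
      have : ∫ t in Ioo (-1 : ℝ) 1, u t * Q m (m + j) t = normConst m (m + j) *
          ∫ t in Ioo (-1 : ℝ) 1, u t * omega t ^ m * (dLegendre m (m + j)).eval t := by
        rw [← integral_const_mul]
        congr 1
        ext t
        rw [Q_eq]
        ring
      rw [this] at hj
      exact (mul_eq_zero.1 hj).resolve_left (normConst_pos _ _).ne'
    | zero => simp
    | add p q _ _ hp hq =>
      simp only [eval_add, mul_add]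
      rw [integral_add (hint p) (hint q), hp, hq, add_zero]
    | smul a p _ hp =>
      simp only [eval_smul, smul_eq_mul, mul_left_comm _ a]
      rw [integral_const_mul, hp, mul_zero]
  rw [Lp.eq_zero_iff_ae_eq_zero]
  filter_upwards [hz, ae_mem_Ioo] with t ht hI
  exact (mul_eq_zero.1 ht).resolve_right (pow_pos (omega_pos hI) m).ne'

/-- The Hilbert basis `(Qₙᵐ)_{n ≥ m}` of `L²(-1,1)`, indexed by `j = n - m`. -/
def qBasis (m : ℕ) : HilbertBasis ℕ ℝ L2 :=
  HilbertBasis.mkOfOrthogonalEqBot (orthonormal_qVec m) (by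
    rw [Submodule.eq_bot_iff]
    intro u hu
    refine eq_zero_of_inner_qVec m fun j => ?_
    rw [real_inner_comm]
    exact hu _ (Submodule.subset_span ⟨j, rfl⟩))

theorem qBasis_apply (m j : ℕ) : qBasis m j = qVec m (m + j) := by
  simp [qBasis]

theorem hasSum_coeff_mul_coeff (m : ℕ) (u v : L2) :
    HasSum (fun j => coeff m (m + j) u * coeff m (m + j) v) (inner ℝ u v) := by
  have h := (qBasis m).hasSum_inner_mul_inner u v
  simp only [qBasis_apply] at h
  simpa only [coeff_eq_inner, real_inner_comm v] using h

theorem hasSum_coeff_sq (m : ℕ) {f : ℝ → ℝ} (hf : MemLp f 2 mu) :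
    HasSum (fun j => coeff m (m + j) (hf.toLp f) ^ 2) (∫ t in Ioo (-1 : ℝ) 1, |f t| ^ 2) := by
  have h := hasSum_coeff_mul_coeff m (hf.toLp f) (hf.toLp f)
  rw [inner_toLp] at h
  have e : ∫ t in Ioo (-1 : ℝ) 1, (hf.toLp f) t * f t = ∫ t in Ioo (-1 : ℝ) 1, |f t| ^ 2 := by
    refine integral_congr_ae ?_
    filter_upwards [hf.coeFn_toLp] with t ht
    rw [ht, sq_abs, sq]
  rw [e] at h
  simpa only [sq] using h

/-- Riesz–Fischer for the basis `Qₙᵐ`. -/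
theorem exists_coeff_eq (m : ℕ) {a : ℕ → ℝ} (ha : Summable fun j => a j ^ 2) :
    ∃ w : L2, ∀ j, coeff m (m + j) w = a j := by
  have hm : Memℓp a 2 := by
    refine memℓp_gen ?_
    simpa using ha
  refine ⟨(qBasis m).repr.symm ⟨a, hm⟩, fun j => ?_⟩
  rw [coeff_eq_inner, real_inner_comm, ← qBasis_apply, ← HilbertBasis.repr_apply_apply,
    LinearIsometryEquiv.apply_symm_apply]

/-! ### Weak derivatives tested against polynomials -/

theorem iteratedDeriv_eval (p : ℝ[X]) (k : ℕ) :
    iteratedDeriv k (fun t => p.eval t) = fun t => (derivative^[k] p).eval t := by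
  induction k with
  | zero => simp
  | succ k ih =>
    rw [iteratedDeriv_succ, ih, Function.iterate_succ_apply']
    ext t
    exact Polynomial.deriv _

/-- Smooth functions which vanish on `(-∞, 1)` and are constant on `(2, ∞)`. -/
structure IsProfile (Ψ : ℝ → ℝ) : Prop where
  contDiff : ContDiff ℝ ∞ Ψ
  eq_zero : ∀ s < 1, Ψ s = 0
  eq_const : ∃ c, ∀ s > 2, Ψ s = c

theorem IsProfile.exists_bound {Ψ : ℝ → ℝ} (h : IsProfile Ψ) : ∃ C, 0 ≤ C ∧ ∀ s, |Ψ s| ≤ C := by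
  obtain ⟨c, hc⟩ := h.eq_const
  obtain ⟨C, hC⟩ := (isCompact_Icc (a := (1 : ℝ)) (b := 2)).exists_bound_of_continuousOn
    h.contDiff.continuous.continuousOn
  have hC0 : 0 ≤ C := (norm_nonneg _).trans (hC 1 (by norm_num))
  refine ⟨max C |c|, le_max_of_le_left hC0, fun s => ?_⟩
  rcases lt_or_ge s 1 with h1 | h1
  · simp [h.eq_zero s h1, hC0]
  rcases le_or_gt s 2 with h2 | h2
  · exact le_max_of_le_left (hC s ⟨h1, h2⟩)
  · rw [hc s h2]
    exact le_max_right _ _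

/-- Profiles are stable under the Euler-type operators `Ψ ↦ a Ψ + s Ψ'`. -/
theorem IsProfile.euler {Ψ : ℝ → ℝ} (h : IsProfile Ψ) (a : ℝ) :
    IsProfile fun s => a * Ψ s + s * deriv Ψ s := by
  obtain ⟨c, hc⟩ := h.eq_const
  have hd : ContDiff ℝ ∞ (deriv Ψ) := (contDiff_infty_iff_deriv.1 h.contDiff).2
  refine ⟨(contDiff_const.mul h.contDiff).add (contDiff_id.mul hd), fun s hs => ?_,
    a * c, fun s hs => ?_⟩
  · have : Ψ =ᶠ[𝓝 s] fun _ => 0 := by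
      filter_upwards [Iio_mem_nhds hs] with x hx using h.eq_zero x hx
    simp [h.eq_zero s hs, this.deriv_eq]
  · have : Ψ =ᶠ[𝓝 s] fun _ => c := by
      filter_upwards [Ioi_mem_nhds hs] with x hx using hc x hx
    simp [hc s hs, this.deriv_eq]

theorem contDiff_cutoff {Ψ : ℝ → ℝ} (h : ContDiff ℝ ∞ Ψ) (p : ℝ[X]) (a : ℕ) (ε : ℝ) :
    ContDiff ℝ ∞ fun t => p.eval t * (1 - t ^ 2) ^ a * Ψ ((1 - t ^ 2) / ε) := by
  have hp : ContDiff ℝ ∞ fun t => p.eval t := by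
    simpa using p.contDiff_aeval (𝕜 := ℝ) ∞
  have h1 : ContDiff ℝ ∞ fun t : ℝ => (1 - t ^ 2) / ε := by fun_prop
  have h2 : ContDiff ℝ ∞ fun t : ℝ => (1 - t ^ 2) ^ a := by fun_prop
  exact (hp.mul h2).mul (h.comp h1)

theorem deriv_cutoff {Ψ : ℝ → ℝ} (h : ContDiff ℝ ∞ Ψ) (p : ℝ[X]) (a : ℕ) {ε : ℝ} (t : ℝ) :
    deriv (fun t => p.eval t * (1 - t ^ 2) ^ (a + 1) * Ψ ((1 - t ^ 2) / ε)) t =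
      (derivative p * (1 - Polynomial.X ^ 2)).eval t * (1 - t ^ 2) ^ a * Ψ ((1 - t ^ 2) / ε) +
      (C (-2) * Polynomial.X * p).eval t * (1 - t ^ 2) ^ a *
        ((fun s => ((a + 1 : ℕ) : ℝ) * Ψ s + s * deriv Ψ s) ((1 - t ^ 2) / ε)) := by
  have h0 : HasDerivAt (fun t : ℝ => 1 - t ^ 2) (-(2 * t)) t := by
    simpa using (hasDerivAt_pow 2 t).const_sub 1
  have h1 := (h0.div_const ε)
  have h2 : HasDerivAt Ψ (deriv Ψ ((1 - t ^ 2) / ε)) ((1 - t ^ 2) / ε) :=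
    (h.differentiable (by simp)).differentiableAt.hasDerivAt
  have h3 := h2.comp t h1
  have h4 := ((p.hasDerivAt t).mul (h0.pow (a + 1))).mul h3
  refine h4.deriv.trans ?_
  simp only [eval_mul, eval_sub, eval_pow, eval_one, eval_X, eval_C, Function.comp,
    Nat.add_sub_cancel, Pi.mul_apply, Pi.pow_apply]
  push_cast
  ring

/-- Cutting off at distance `ε` from the end points costs a factor `ε⁻¹` per derivative, which the
powers of `1 - t²` absorb, uniformly in `ε`. -/
theorem exists_bound_iteratedDeriv_cutoff (k a : ℕ) (p : ℝ[X]) {Ψ : ℝ → ℝ} (h : IsProfile Ψ) :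
    ∃ C, ∀ ε > 0, ∀ t ∈ Ioo (-1 : ℝ) 1,
      |iteratedDeriv k (fun t => p.eval t * (1 - t ^ 2) ^ (a + k) * Ψ ((1 - t ^ 2) / ε)) t| ≤
        C * (1 - t ^ 2) ^ a := by
  induction k generalizing p Ψ with
  | zero =>
    obtain ⟨C₁, h1, hC₁⟩ := exists_bound_Ioo p.continuous
    obtain ⟨C₂, h2, hC₂⟩ := h.exists_bound
    refine ⟨C₁ * C₂, fun ε _ t ht => ?_⟩
    have h3 : 0 ≤ (1 - t ^ 2) ^ a := (pow_pos (one_sub_sq_pos ht) a).le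
    rw [iteratedDeriv_zero, abs_mul, abs_mul, add_zero, abs_of_nonneg h3, mul_right_comm]
    gcongr
    · exact hC₁ t ht
    · exact hC₂ _
  | succ k ih =>
    obtain ⟨C₁, hC₁⟩ := ih (derivative p * (1 - Polynomial.X ^ 2)) h
    obtain ⟨C₂, hC₂⟩ := ih (C (-2) * Polynomial.X * p) (h.euler ((a + k + 1 : ℕ) : ℝ))
    refine ⟨C₁ + C₂, fun ε hε t ht => ?_⟩
    rw [iteratedDeriv_succ', ← add_assoc,
      funext fun t => deriv_cutoff h.contDiff p (a + k) (ε := ε) t,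
      iteratedDeriv_fun_add
        ((contDiff_cutoff h.contDiff _ _ _).of_le (mod_cast le_top)).contDiffAt
        ((contDiff_cutoff (h.euler _).contDiff _ _ _).of_le (mod_cast le_top)).contDiffAt, add_mul]
    exact (abs_add_le _ _).trans (add_le_add (hC₁ ε hε t ht) (hC₂ ε hε t ht))

theorem isProfile_smoothTransition : IsProfile fun s => Real.smoothTransition (s - 1) := by
  refine ⟨Real.smoothTransition.contDiff.comp (contDiff_id.sub contDiff_const), fun s hs => ?_,
    1, fun s hs => ?_⟩
  · exact Real.smoothTransition.zero_of_nonpos (by linarith)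
  · exact Real.smoothTransition.one_of_one_le (by linarith)

/-- The test function `p (1 - t²)ᵃ`, cut off where `1 - t² ≤ ε`. -/
def cutoff (p : ℝ[X]) (a : ℕ) (ε : ℝ) (hε : 0 < ε) : 𝓓(I, ℝ) :=
  have hs : tsupport (fun t : ℝ => p.eval t * (1 - t ^ 2) ^ a *
      Real.smoothTransition ((1 - t ^ 2) / ε - 1)) ⊆ {t : ℝ | ε ≤ 1 - t ^ 2} := by
    refine closure_minimal (fun t ht => ?_) (isClosed_le (by fun_prop) (by fun_prop))
    by_contra h
    refine ht ?_
    have : (1 - t ^ 2) / ε - 1 ≤ 0 := by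
      rw [sub_nonpos, div_le_one hε]
      exact (not_le.1 h).le
    simp only [Real.smoothTransition.zero_of_nonpos this, mul_zero]
  have hI : {t : ℝ | ε ≤ 1 - t ^ 2} ⊆ Ioo (-1) 1 := by
    intro t ht
    have h2 : ε ≤ 1 - t ^ 2 := ht
    exact abs_lt.1 ((sq_lt_one_iff_abs_lt_one t).1 (by linarith))
  { toFun := fun t => p.eval t * (1 - t ^ 2) ^ a * Real.smoothTransition ((1 - t ^ 2) / ε - 1)
    contDiff' := contDiff_cutoff isProfile_smoothTransition.contDiff p a ε
    hasCompactSupport' := HasCompactSupport.of_support_subset_isCompact isCompact_Icc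
      ((subset_tsupport _).trans (hs.trans (hI.trans Ioo_subset_Icc_self)))
    tsupport_subset' := hs.trans hI }

theorem cutoff_coe (p : ℝ[X]) (a : ℕ) (ε : ℝ) (hε : 0 < ε) : ⇑(cutoff p a ε hε) =
    fun t => p.eval t * (1 - t ^ 2) ^ a * Real.smoothTransition ((1 - t ^ 2) / ε - 1) := rfl

theorem eventually_iteratedDeriv_cutoff (p : ℝ[X]) (a k : ℕ) {t : ℝ} (ht : t ∈ Ioo (-1 : ℝ) 1) :
    ∀ᶠ n : ℕ in atTop, iteratedDeriv k (cutoff p a (1 / ((n : ℝ) + 1)) (by positivity)) t =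
      (derivative^[k] ((1 - Polynomial.X ^ 2) ^ a * p)).eval t := by
  have hlim := tendsto_one_div_add_atTop_nhds_zero_nat (𝕜 := ℝ)
  have hpos := one_sub_sq_pos ht
  filter_upwards [hlim.eventually_lt_const (half_pos hpos)] with n hn
  rw [← congrFun (iteratedDeriv_eval _ k) t]
  refine Filter.EventuallyEq.iteratedDeriv_eq k ?_
  have hc : ContinuousAt (fun x : ℝ => (1 - x ^ 2) / 2) t := by fun_prop
  filter_upwards [hc.eventually_const_lt hn] with x hx
  have : 1 ≤ (1 - x ^ 2) / (1 / ((n : ℝ) + 1)) - 1 := by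
    rw [le_sub_iff_add_le, le_div_iff₀ (by positivity)]
    linarith
  simp only [cutoff_coe, Real.smoothTransition.one_of_one_le this, eval_mul, eval_pow,
    eval_sub, eval_one, eval_X]
  ring

/-- A weak derivative may be tested against `(1 - t²)^(a + k) p`, which is not compactly supported
in `(-1,1)`, as soon as the weights make both sides integrable. -/
theorem IsWeakDeriv.integral_polynomial {k a : ℕ} {v g : ℝ → ℝ} (h : IsWeakDeriv k v g)
    (hv : Integrable (fun t => v t * (1 - t ^ 2) ^ a) mu)
    (hg : Integrable (fun t => g t * (1 - t ^ 2) ^ (a + k)) mu) (p : ℝ[X]) :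
    ∫ t in Ioo (-1 : ℝ) 1,
        v t * (derivative^[k] ((1 - Polynomial.X ^ 2) ^ (a + k) * p)).eval t =
      (-1) ^ k * ∫ t in Ioo (-1 : ℝ) 1, g t * ((1 - Polynomial.X ^ 2) ^ (a + k) * p).eval t := by
  let φ : ℕ → 𝓓(I, ℝ) := fun n => cutoff p (a + k) (1 / ((n : ℝ) + 1)) (by positivity)
  have hvm : AEStronglyMeasurable v mu := h.locallyIntegrable_left.aestronglyMeasurable
  have hgm : AEStronglyMeasurable g mu := h.locallyIntegrable_right.aestronglyMeasurable
  obtain ⟨C₁, hC₁⟩ := exists_bound_iteratedDeriv_cutoff k a p isProfile_smoothTransition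
  obtain ⟨C₂, hC₂⟩ := exists_bound_iteratedDeriv_cutoff 0 (a + k) p isProfile_smoothTransition
  have l1 : Tendsto (fun n => ∫ t in Ioo (-1 : ℝ) 1, v t * iteratedDeriv k (φ n) t) atTop
      (𝓝 (∫ t in Ioo (-1 : ℝ) 1,
        v t * (derivative^[k] ((1 - Polynomial.X ^ 2) ^ (a + k) * p)).eval t)) := by
    refine tendsto_integral_of_dominated_convergence (fun t => C₁ * |v t * (1 - t ^ 2) ^ a|)
      (fun n => hvm.mul ?_) (hv.abs.const_mul C₁) (fun n => ?_) ?_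
    · exact ((φ n).contDiff.continuous_iteratedDeriv k (mod_cast le_top)).aestronglyMeasurable
    · filter_upwards [ae_mem_Ioo] with t ht
      rw [Real.norm_eq_abs, abs_mul, abs_mul, abs_of_pos (pow_pos (one_sub_sq_pos ht) a),
        mul_left_comm]
      exact mul_le_mul_of_nonneg_left (hC₁ _ (by positivity) t ht) (abs_nonneg _)
    · filter_upwards [ae_mem_Ioo] with t ht
      refine tendsto_const_nhds.congr' ?_
      filter_upwards [eventually_iteratedDeriv_cutoff p (a + k) k ht] with n hn
      rw [hn]
  have l2 : Tendsto (fun n => ∫ t in Ioo (-1 : ℝ) 1, g t * φ n t) atTop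
      (𝓝 (∫ t in Ioo (-1 : ℝ) 1, g t * ((1 - Polynomial.X ^ 2) ^ (a + k) * p).eval t)) := by
    refine tendsto_integral_of_dominated_convergence (fun t => C₂ * |g t * (1 - t ^ 2) ^ (a + k)|)
      (fun n => hgm.mul (φ n).continuous.aestronglyMeasurable) (hg.abs.const_mul C₂)
      (fun n => ?_) ?_
    · filter_upwards [ae_mem_Ioo] with t ht
      rw [Real.norm_eq_abs, abs_mul, abs_mul, abs_of_pos (pow_pos (one_sub_sq_pos ht) (a + k)),
        mul_left_comm]
      have := hC₂ (1 / ((n : ℝ) + 1)) (by positivity) t ht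
      rw [iteratedDeriv_zero, add_zero] at this
      exact mul_le_mul_of_nonneg_left this (abs_nonneg _)
    · filter_upwards [ae_mem_Ioo] with t ht
      refine tendsto_const_nhds.congr' ?_
      filter_upwards [eventually_iteratedDeriv_cutoff p (a + k) 0 ht] with n hn
      rw [iteratedDeriv_zero, Function.iterate_zero_apply] at hn
      rw [hn]
  refine tendsto_nhds_unique l1 ((l2.const_mul ((-1) ^ k)).congr fun n => ?_)
  exact (h.integral_eq (φ n)).symm

/-- The Fourier coefficients of `ω^(m+k) (ω^(-m) u)^(k)` with respect to `Qₙ^(m+k)`. -/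
theorem IsWeakDeriv.coeff_toLp_sq {m k : ℕ} {u : L2} {g : ℝ → ℝ}
    (h : IsWeakDeriv k (unweight m u) g) (hg : MemLp (fun t => omega t ^ (m + k) * g t) 2 mu)
    (j : ℕ) : coeff (m + k) (m + k + j) (hg.toLp _) ^ 2 =
      eig m k (m + k + j) * coeff m (m + k + j) u ^ 2 := by
  set n := m + k + j with hn
  have hω : ∀ i, MemLp (fun t => omega t ^ i) 2 mu := fun i =>
    memLp_of_continuous (continuous_omega.pow i)
  have hv' : ∀ t ∈ Ioo (-1 : ℝ) 1, unweight m u t * (1 - t ^ 2) ^ m = u t * omega t ^ m := by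
    intro t ht
    have := (pow_pos (omega_pos ht) m).ne'
    rw [unweight, ← omega_pow_mul_self ht]
    field_simp
  have hg' : ∀ t ∈ Ioo (-1 : ℝ) 1, g t * (1 - t ^ 2) ^ (m + k) =
      omega t ^ (m + k) * g t * omega t ^ (m + k) := by
    intro t ht
    rw [← omega_pow_mul_self ht]
    ring
  have hv : Integrable (fun t => unweight m u t * (1 - t ^ 2) ^ m) mu :=
    (integrable_mul_of_memLp (Lp.memLp u) (hω m)).congr
      (ae_mem_Ioo.mono fun t ht => (hv' t ht).symm)
  have hgi : Integrable (fun t => g t * (1 - t ^ 2) ^ (m + k)) mu :=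
    (integrable_mul_of_memLp hg (hω (m + k))).congr
      (ae_mem_Ioo.mono fun t ht => (hg' t ht).symm)
  have key := h.integral_polynomial hv hgi (dLegendre (m + k) n)
  rw [iterate_derivative_weighted_dLegendre] at key
  have e1 : ∫ t in Ioo (-1 : ℝ) 1, unweight m u t * (C ((-1) ^ k * eig m k n) *
      ((1 - Polynomial.X ^ 2) ^ m * dLegendre m n)).eval t =
      (-1) ^ k * eig m k n * ∫ t in Ioo (-1 : ℝ) 1, u t * omega t ^ m * (dLegendre m n).eval t := by
    rw [← integral_const_mul]
    refine setIntegral_congr_fun measurableSet_Ioo fun t ht => ?_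
    simp only [eval_mul, eval_pow, eval_sub, eval_one, eval_X, eval_C]
    linear_combination ((-1) ^ k * eig m k n) * (dLegendre m n).eval t * hv' t ht
  have e2 : ∫ t in Ioo (-1 : ℝ) 1, g t * ((1 - Polynomial.X ^ 2) ^ (m + k) *
      dLegendre (m + k) n).eval t =
      ∫ t in Ioo (-1 : ℝ) 1, omega t ^ (m + k) * g t *
        (omega t ^ (m + k) * (dLegendre (m + k) n).eval t) := by
    refine setIntegral_congr_fun measurableSet_Ioo fun t ht => ?_
    simp only [eval_mul, eval_pow, eval_sub, eval_one, eval_X]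
    linear_combination (dLegendre (m + k) n).eval t * hg' t ht
  rw [e1, e2] at key
  have e3 : coeff m n u = normConst m n *
      ∫ t in Ioo (-1 : ℝ) 1, u t * omega t ^ m * (dLegendre m n).eval t := by
    rw [coeff, ← integral_const_mul]
    congr 1
    ext t
    rw [Q_eq]
    ring
  have e4 : coeff (m + k) n (hg.toLp _) = normConst (m + k) n *
      ∫ t in Ioo (-1 : ℝ) 1, omega t ^ (m + k) * g t *
        (omega t ^ (m + k) * (dLegendre (m + k) n).eval t) := by
    rw [coeff, ← integral_const_mul]
    refine integral_congr_ae ?_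
    filter_upwards [hg.coeFn_toLp] with t ht
    rw [ht, Q_eq]
    ring
  have e5 : ((-1 : ℝ) ^ k) ≠ 0 := by simp
  have e6 : eig m k n * ∫ t in Ioo (-1 : ℝ) 1, u t * omega t ^ m * (dLegendre m n).eval t =
      ∫ t in Ioo (-1 : ℝ) 1, omega t ^ (m + k) * g t *
        (omega t ^ (m + k) * (dLegendre (m + k) n).eval t) :=
    mul_left_cancel₀ e5 (by rw [← key]; ring)
  rw [e3, e4, ← e6, mul_pow, mul_pow, mul_pow, normConst_sq_eq_eig_mul]
  ring

/-! ### Construction of weak derivatives -/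

theorem tsupport_iteratedDeriv_subset (k : ℕ) (f : ℝ → ℝ) :
    tsupport (iteratedDeriv k f) ⊆ tsupport f := by
  induction k with
  | zero => simp
  | succ k ih =>
    rw [iteratedDeriv_succ]
    exact tsupport_deriv_subset.trans ih

theorem continuous_iteratedDeriv_test (k : ℕ) (φ : 𝓓(I, ℝ)) : Continuous (iteratedDeriv k φ) :=
  φ.contDiff.continuous_iteratedDeriv k (mod_cast le_top)

theorem tsupport_iteratedDeriv_test (k : ℕ) (φ : 𝓓(I, ℝ)) :
    tsupport (iteratedDeriv k φ) ⊆ Ioo (-1) 1 :=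
  (tsupport_iteratedDeriv_subset k φ).trans φ.tsupport_subset

/-- Polynomials have their classical derivatives as weak derivatives. -/
theorem integral_iteratedDeriv_mul_eval (k : ℕ) (p : ℝ[X]) (φ : 𝓓(I, ℝ)) :
    ∫ t in Ioo (-1 : ℝ) 1, p.eval t * iteratedDeriv k φ t =
      (-1) ^ k * ∫ t in Ioo (-1 : ℝ) 1, (derivative^[k] p).eval t * φ t := by
  induction k generalizing p with
  | zero => simp
  | succ k ih =>
    have hd : ∀ t, HasDerivAt (iteratedDeriv k φ) (iteratedDeriv (k + 1) φ t) t := by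
      intro t
      rw [iteratedDeriv_succ]
      exact ((φ.contDiff.differentiable_iteratedDeriv k
        (mod_cast ENat.natCast_lt_top k)).differentiableAt).hasDerivAt
    have hz : ∀ t, t ∉ Ioo (-1 : ℝ) 1 → iteratedDeriv k φ t = 0 := fun t ht =>
      image_eq_zero_of_notMem_tsupport fun h => ht (tsupport_iteratedDeriv_test k φ h)
    have h := intervalIntegral.integral_mul_deriv_eq_deriv_mul (a := -1) (b := 1)
      (fun t _ => p.hasDerivAt t) (fun t _ => hd t)
      ((derivative p).continuous.intervalIntegrable _ _)
      ((continuous_iteratedDeriv_test (k + 1) φ).intervalIntegrable _ _)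
    rw [hz 1 (by simp), hz (-1) (by simp), ← integral_Ioo_eq, ← integral_Ioo_eq, ih] at h
    rw [h, Function.iterate_succ_apply]
    ring

theorem continuous_inv_omega_pow_mul (m : ℕ) {ψ : ℝ → ℝ} (hψ : Continuous ψ)
    (hs : tsupport ψ ⊆ Ioo (-1) 1) : Continuous fun t => (omega t ^ m)⁻¹ * ψ t := by
  rw [continuous_iff_continuousAt]
  intro t
  by_cases ht : t ∈ Ioo (-1 : ℝ) 1
  · exact ((continuous_omega.pow m).continuousAt.inv₀ (pow_pos (omega_pos ht) m).ne').mul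
      hψ.continuousAt
  · have h0 := notMem_tsupport_iff_eventuallyEq.1 fun h => ht (hs h)
    refine (continuousAt_const (y := (0 : ℝ))).congr ?_
    filter_upwards [h0] with x hx
    simp [hx]

theorem locallyIntegrableOn_unweight (m : ℕ) (u : L2) :
    LocallyIntegrableOn (unweight m u) (Ioo (-1) 1) := by
  have h : Integrable u mu := (Lp.memLp u).integrable (by norm_num)
  refine (IntegrableOn.locallyIntegrableOn h).continuousOn_mul
    (g := fun t => (omega t ^ m)⁻¹) ?_ isOpen_Ioo.isLocallyClosed
  exact (continuous_omega.pow m).continuousOn.inv₀ fun t ht => (pow_pos (omega_pos ht) m).ne'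

/-- The functional `u ↦ ∫ ω^(-m) u ψ` expanded in the basis `Qₙᵐ`. -/
theorem hasSum_integral_unweight_mul (m : ℕ) (u : L2) {ψ : ℝ → ℝ} (hψ : Continuous ψ)
    (hs : tsupport ψ ⊆ Ioo (-1) 1) :
    HasSum (fun j => coeff m (m + j) u * (normConst m (m + j) *
        ∫ t in Ioo (-1 : ℝ) 1, (dLegendre m (m + j)).eval t * ψ t))
      (∫ t in Ioo (-1 : ℝ) 1, unweight m u t * ψ t) := by
  have hm := memLp_of_continuous (continuous_inv_omega_pow_mul m hψ hs)
  have h := hasSum_coeff_mul_coeff m u (hm.toLp _)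
  have e : inner ℝ u (hm.toLp _) = ∫ t in Ioo (-1 : ℝ) 1, unweight m u t * ψ t := by
    rw [inner_toLp]
    congr 1
    ext t
    rw [unweight]
    ring
  rw [e] at h
  refine h.congr_fun ?_
  intro j
  congr 1
  rw [coeff, ← integral_const_mul]
  refine integral_congr_ae ?_
  filter_upwards [hm.coeFn_toLp, ae_mem_Ioo] with t ht hI
  have := (pow_pos (omega_pos hI) m).ne'
  rw [ht, Q_eq]
  field_simp

/-- An element of `L²(-1,1)` with the Fourier coefficients that `ω^(m+k) (ω^(-m) u)^(k)` must have
provides the weak derivative. -/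
theorem isWeakDeriv_unweight {m k : ℕ} {u w : L2}
    (hw : ∀ j, coeff (m + k) (m + k + j) w =
      normConst m (m + k + j) / normConst (m + k) (m + k + j) * coeff m (m + k + j) u) :
    IsWeakDeriv k (unweight m u) (unweight (m + k) w) := by
  refine ⟨locallyIntegrableOn_unweight m u, locallyIntegrableOn_unweight (m + k) w, fun φ => ?_⟩
  have h1 := hasSum_integral_unweight_mul m u (continuous_iteratedDeriv_test k φ)
    (tsupport_iteratedDeriv_test k φ)
  have h2 := (hasSum_integral_unweight_mul (m + k) w φ.continuous φ.tsupport_subset).mul_left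
    ((-1) ^ k)
  -- The first `k` terms vanish, because `Pₙ^(m+k) = 0` for `n < m + k`.
  rw [← hasSum_nat_add_iff' k, Finset.sum_eq_zero, sub_zero] at h1
  · refine h1.unique (h2.congr_fun ?_)
    intro j
    rw [hw, show m + (j + k) = m + k + j by ring, integral_iteratedDeriv_mul_eval,
      iterate_derivative_dLegendre]
    have := (normConst_pos (m + k) (m + k + j)).ne'
    field_simp
  · intro j hj
    rw [integral_iteratedDeriv_mul_eval, iterate_derivative_dLegendre,
      dLegendre_eq_zero (by have := Finset.mem_range.1 hj; omega)]
    simp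

/-! ### Uniqueness of weak derivatives -/

theorem integrable_mul_test {g φ : ℝ → ℝ} (hg : LocallyIntegrableOn g (Ioo (-1) 1))
    (hφ : Continuous φ) (hc : HasCompactSupport φ) (hs : tsupport φ ⊆ Ioo (-1) 1) :
    Integrable (fun t => g t * φ t) mu := by
  have h := (hg.integrableOn_compact_subset hs hc).mul_continuousOn hφ.continuousOn hc
  refine Integrable.integrableOn ((integrableOn_iff_integrable_of_support_subset ?_).1 h)
  exact (Function.support_mul_subset_right _ _).trans (subset_tsupport φ)

theorem IsWeakDeriv.ae_eq {k : ℕ} {f g₁ g₂ : ℝ → ℝ} (h₁ : IsWeakDeriv k f g₁)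
    (h₂ : IsWeakDeriv k f g₂) : g₁ =ᵐ[mu] g₂ := by
  have := isOpen_Ioo.ae_eq_zero_of_integral_contDiff_smul_eq_zero (μ := volume)
    (h₁.locallyIntegrable_right.sub h₂.locallyIntegrable_right) (fun φ hφ hc hs => by
      have e := (h₁.integral_eq ⟨φ, hφ, hc, hs⟩).symm.trans (h₂.integral_eq ⟨φ, hφ, hc, hs⟩)
      have e' := mul_left_cancel₀ (by simp) e
      change ∫ t in Ioo (-1 : ℝ) 1, g₁ t * φ t = ∫ t in Ioo (-1 : ℝ) 1, g₂ t * φ t at e'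
      rw [← setIntegral_eq_integral_of_forall_compl_eq_zero (s := Ioo (-1 : ℝ) 1)]
      · simp only [smul_eq_mul, Pi.sub_apply, mul_comm (φ _), sub_mul]
        rw [integral_sub (integrable_mul_test h₁.locallyIntegrable_right hφ.continuous hc hs)
          (integrable_mul_test h₂.locallyIntegrable_right hφ.continuous hc hs), e', sub_self]
      · intro t ht
        rw [image_eq_zero_of_notMem_tsupport fun h' => ht (hs h'), zero_smul])
  have h' := (ae_restrict_iff' measurableSet_Ioo).2 this
  filter_upwards [h'] with t ht
  exact sub_eq_zero.1 ht

/-! ### Parseval's identity and comparison of the norms -/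

/-- The weighted Sobolev seminorm of `u` as a weighted sum of the squares of its coefficients. -/
theorem hasSum_eig_mul_coeff_sq {m k : ℕ} {u : L2} {g : ℝ → ℝ}
    (h : IsWeakDeriv k (unweight m u) g) (hg : MemLp (fun t => omega t ^ (m + k) * g t) 2 mu) :
    HasSum (fun j => eig m k (m + j) * coeff m (m + j) u ^ 2)
      (∫ t in Ioo (-1 : ℝ) 1, omega t ^ (2 * (m + k)) * |g t| ^ 2) := by
  have h1 := hasSum_coeff_sq (m + k) hg
  have e : ∫ t in Ioo (-1 : ℝ) 1, |omega t ^ (m + k) * g t| ^ 2 =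
      ∫ t in Ioo (-1 : ℝ) 1, omega t ^ (2 * (m + k)) * |g t| ^ 2 := by
    congr 1
    ext t
    rw [sq_abs, sq_abs]
    ring
  rw [e] at h1
  -- The eigenvalue vanishes for `m ≤ n < m + k`.
  rw [← hasSum_nat_add_iff' k, Finset.sum_eq_zero, sub_zero]
  · refine h1.congr_fun ?_
    intro j
    rw [h.coeff_toLp_sq hg, show m + (j + k) = m + k + j by ring]
  · intro j hj
    rw [eig_eq_zero (Finset.mem_range.1 hj), zero_mul]

theorem hasSum_coeff_sq_self (m : ℕ) (u : L2) :
    HasSum (fun j => coeff m (m + j) u ^ 2) (∫ t in Ioo (-1 : ℝ) 1, |u t| ^ 2) := by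
  simpa using hasSum_coeff_sq m (Lp.memLp u)

theorem lowerConst_pos (m : ℕ) {k : ℕ} (hk : 1 ≤ k) : 0 < lowerConst m k := by
  have : (1 : ℝ) ≤ k := by exact_mod_cast hk
  have h : 0 < 2 * (m : ℝ) + 2 * k - 1 := by
    have : (0 : ℝ) ≤ m := by positivity
    linarith
  unfold lowerConst
  refine lt_min ?_ ?_ <;> positivity

theorem two_mul_add_one_pow (x : ℝ) (k : ℕ) :
    (2 * x + 1) ^ (2 * k) = 2 ^ (2 * k) * (x + 1 / 2) ^ (2 * k) := by
  rw [← mul_pow]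
  ring

/-- For `n = m + j < m + k` the eigenvalue vanishes and the second entry of the minimum defining
`lowerConst` is needed; for `n ≥ m + k` the first one suffices, by `le_eig`. -/
theorem lowerConst_mul_le (m : ℕ) {k : ℕ} (hk : 1 ≤ k) (j : ℕ) :
    lowerConst m k * (2 * ((m + j : ℕ) : ℝ) + 1) ^ (2 * k) ≤
      ((m : ℝ) + 1 / 2) ^ (2 * k) + eig m k (m + j) := by
  have hk' : (1 : ℝ) ≤ k := by exact_mod_cast hk
  have hm : (0 : ℝ) ≤ m := by positivity
  rcases lt_or_ge j k with h | h
  · have hj : (j : ℝ) + 1 ≤ k := by exact_mod_cast h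
    have h0 : 0 < 2 * (m : ℝ) + 2 * k - 1 := by linarith
    rw [eig_eq_zero h, add_zero]
    refine (mul_le_mul_of_nonneg_right (min_le_right _ _) (by positivity)).trans ?_
    rw [div_mul_eq_mul_div, div_le_iff₀ (by positivity)]
    gcongr
    push_cast
    linarith
  · refine (mul_le_mul_of_nonneg_right (min_le_left _ _) (by positivity)).trans ?_
    have h1 := le_eig m k j h
    have h2 : 0 ≤ ((m : ℝ) + 1 / 2) ^ (2 * k) := by positivity
    rw [two_mul_add_one_pow]
    calc _ = ((m + 1).factorial / (m + k + 1).factorial : ℝ) *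
          (((m + j : ℕ) : ℝ) + 1 / 2) ^ (2 * k) := by field_simp
      _ ≤ _ := by linarith

theorem le_zpow_mul (m k j : ℕ) :
    ((m : ℝ) + 1 / 2) ^ (2 * k) + eig m k (m + j) ≤
      (2 : ℝ) ^ (1 - 2 * (k : ℤ)) * (2 * ((m + j : ℕ) : ℝ) + 1) ^ (2 * k) := by
  have h1 := eig_le m k j
  have h2 : ((m : ℝ) + 1 / 2) ^ (2 * k) ≤ (((m + j : ℕ) : ℝ) + 1 / 2) ^ (2 * k) := by
    gcongr
    omega
  have h3 : (2 : ℝ) ^ (1 - 2 * (k : ℤ)) * 2 ^ (2 * k) = 2 := by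
    rw [zpow_sub₀ two_ne_zero, zpow_one, show 2 * (k : ℤ) = ((2 * k : ℕ) : ℤ) by push_cast; ring,
      zpow_natCast]
    field_simp
  rw [two_mul_add_one_pow, ← mul_assoc, h3]
  linarith

theorem mem_X_of_mem_H {m k : ℕ} {u : L2} (hu : u ∈ H m k) : u ∈ X m k := by
  have hu' : Summable (normTerm m k u) := hu
  have hs : Summable fun j => (normConst m (m + k + j) / normConst (m + k) (m + k + j) *
      coeff m (m + k + j) u) ^ 2 := by
    refine Summable.of_nonneg_of_le (fun j => sq_nonneg _) (fun j => ?_)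
      ((summable_nat_add_iff k).2 hu')
    have h0 := (normConst_pos (m + k) (m + k + j)).ne'
    have h1 : (normConst m (m + k + j) / normConst (m + k) (m + k + j)) ^ 2 =
        eig m k (m + k + j) := by
      rw [div_pow, normConst_sq_eq_eig_mul]
      field_simp
    rw [mul_pow, h1, normTerm, show m + (j + k) = m + k + j by ring]
    refine mul_le_mul_of_nonneg_right ?_ (sq_nonneg _)
    rw [add_assoc]
    refine (eig_le m k (k + j)).trans ?_
    have : (0 : ℝ) ≤ ((m + (k + j) : ℕ) : ℝ) := by positivity
    gcongr
    · linarith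
    · norm_num
  obtain ⟨w, hw⟩ := exists_coeff_eq (m + k) hs
  refine ⟨_, isWeakDeriv_unweight hw, (memLp_congr_ae ?_).1 (Lp.memLp w)⟩
  filter_upwards [ae_mem_Ioo] with t ht
  have := (pow_pos (omega_pos ht) (m + k)).ne'
  rw [unweight]
  field_simp

theorem mem_H_of_mem_X {m k : ℕ} (hk : 1 ≤ k) {u : L2} (hu : u ∈ X m k) : u ∈ H m k := by
  obtain ⟨g, h, hg⟩ := hu
  have hs := ((hasSum_coeff_sq_self m u).mul_left (((m : ℝ) + 1 / 2) ^ (2 * k))).add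
    (hasSum_eig_mul_coeff_sq h hg)
  have hc := lowerConst_pos m hk
  have : Summable fun j => lowerConst m k * normTerm m k u j := by
    refine Summable.of_nonneg_of_le (fun j => ?_) (fun j => ?_) hs.summable
    · rw [normTerm]
      positivity
    · rw [normTerm, ← mul_assoc, ← add_mul]
      exact mul_le_mul_of_nonneg_right (lowerConst_mul_le m hk j) (sq_nonneg _)
  exact (summable_mul_left_iff hc.ne').1 this

end LegendreScale

end

theorem mainTheorem2 (m k : ℕ) (hk : 1 ≤ k) :
    LegendreScale.H m k = LegendreScale.X m k ∧
    0 < LegendreScale.lowerConst m k ∧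
    ∀ u ∈ LegendreScale.H m k, ∀ g : ℝ → ℝ,
      LegendreScale.IsWeakDeriv k (LegendreScale.unweight m u) g →
      LegendreScale.lowerConst m k * LegendreScale.hNorm m k u ^ 2 ≤
          ((m : ℝ) + 1 / 2) ^ (2 * k) * (∫ t in Set.Ioo (-1) 1, |u t| ^ 2) +
            ∫ t in Set.Ioo (-1) 1, LegendreScale.omega t ^ (2 * (m + k)) * |g t| ^ 2 ∧
      ((m : ℝ) + 1 / 2) ^ (2 * k) * (∫ t in Set.Ioo (-1) 1, |u t| ^ 2) +
            ∫ t in Set.Ioo (-1) 1, LegendreScale.omega t ^ (2 * (m + k)) * |g t| ^ 2 ≤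
          (2 : ℝ) ^ (1 - 2 * (k : ℤ)) * LegendreScale.hNorm m k u ^ 2 := by
  refine ⟨Set.Subset.antisymm (fun u hu => LegendreScale.mem_X_of_mem_H hu)
    (fun u hu => LegendreScale.mem_H_of_mem_X hk hu), LegendreScale.lowerConst_pos m hk,
    fun u hu g hg => ?_⟩
  -- Weak derivatives are unique, so `g` inherits the square integrability from `u ∈ X m k`.
  obtain ⟨g', hg', hm'⟩ := LegendreScale.mem_X_of_mem_H hu
  have hm : MemLp (fun t => LegendreScale.omega t ^ (m + k) * g t) 2 LegendreScale.mu := by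
    refine (memLp_congr_ae ?_).1 hm'
    filter_upwards [hg'.ae_eq hg] with t ht
    rw [ht]
  have hs := ((LegendreScale.hasSum_coeff_sq_self m u).mul_left
    (((m : ℝ) + 1 / 2) ^ (2 * k))).add (LegendreScale.hasSum_eig_mul_coeff_sq hg hm)
  have hu' : Summable (LegendreScale.normTerm m k u) := hu
  have hn : LegendreScale.hNorm m k u ^ 2 = ∑' j, LegendreScale.normTerm m k u j :=
    Real.sq_sqrt (tsum_nonneg fun j => by rw [LegendreScale.normTerm]; positivity)
  rw [hn]
  refine ⟨hasSum_le (fun j => ?_) (hu'.hasSum.mul_left _) hs,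
    hasSum_le (fun j => ?_) hs (hu'.hasSum.mul_left _)⟩
  · rw [LegendreScale.normTerm, ← mul_assoc, ← add_mul]
    exact mul_le_mul_of_nonneg_right (LegendreScale.lowerConst_mul_le m hk j) (sq_nonneg _)
  · rw [LegendreScale.normTerm, ← mul_assoc, ← add_mul]
    exact mul_le_mul_of_nonneg_right (LegendreScale.le_zpow_mul m k j) (sq_nonneg _)
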